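/- Let $M$ be a connected smooth manifold (Hausdorff, second countable, without boundary) and let $E$ be a smooth real vector bundle of finite rank over $M$, with dual bundle $E^*$. A generalized subbundle $G$ of $E$ is an arbitrary assignment of a linear subspace $G_p\subseteq E_p$ to each point $p\in M$. A local section of $E^*$ is a smooth section of $E^*$ defined on some open set $\operatorname{dom}(s)\subseteq M$. Call $G$ cosmooth if there is a (possibly infinite) family $\mathfrak m$ of local sections of $E^*$ such that, for every $p\in M$, $$G_p=\{v\in E_p : s(p)(v)=0 \text{ for all } s\in\mathfrak m \text{ with } p\in\operatorname{dom}(s)\}.$$ If $G$ is a cosmooth generalized subbundle of $E$, then there are finitely many smooth globally defined sections $s_1,\dots,s_k$ of $E^*$ such that, for each $p\in M$, $$G_p=\{v\in E_p : s_1(p)(v)=0,\dots,s_k(p)(v)=0\}.$$ -/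

import Mathlib

open Bundle
open scoped Manifold ContDiff

section GeneralizedSubbundles

variable {n : ℕ} {M : Type*} [TopologicalSpace M] [ChartedSpace (EuclideanSpace ℝ (Fin n)) M]

/-- The fibre at `p` of the dual bundle `E*`: the (continuous) linear functionals on `E p`. The
fibres we consider are finite-dimensional, so that every linear functional is continuous. The bundle
structure on `E*` (with model fibre `F →L[ℝ] ℝ`) is Mathlib's bundle of continuous linear maps. -/
abbrev DualFiber (E : M → Type*) [∀ p, AddCommGroup (E p)] [∀ p, Module ℝ (E p)]
    [∀ p, TopologicalSpace (E p)] (p : M) : Type _ :=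
  E p →L[ℝ] ℝ

/-- A generalized subbundle of `E`: an arbitrary assignment of a linear subspace of `E p` to each
point `p`. -/
abbrev GeneralizedSubbundle (E : M → Type*) [∀ p, AddCommGroup (E p)] [∀ p, Module ℝ (E p)] :
    Type _ :=
  ∀ p : M, Submodule ℝ (E p)

/-- A local section of the smooth vector bundle `V` with model fibre `F`: a smooth section over an
open set `dom`. The function `toFun` is total, but only its values on `dom` are meaningful. -/
structure LocalSection (n : ℕ) {M : Type*} [TopologicalSpace M]
    [ChartedSpace (EuclideanSpace ℝ (Fin n)) M]
    (F : Type*) [NormedAddCommGroup F] [NormedSpace ℝ F]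
    (V : M → Type*) [TopologicalSpace (TotalSpace F V)] [∀ p, TopologicalSpace (V p)]
    [FiberBundle F V] where
  /-- the domain of the section -/
  dom : TopologicalSpace.Opens M
  /-- the value of the section at each point -/
  toFun : ∀ p : M, V p
  /-- the section is smooth on its domain -/
  smooth : ContMDiffOn (𝓡 n) ((𝓡 n).prod 𝓘(ℝ, F)) ∞
    (fun p => (⟨p, toFun p⟩ : TotalSpace F V)) (dom : Set M)

variable {F : Type*} [NormedAddCommGroup F] [NormedSpace ℝ F]
  {E : M → Type*} [∀ p, AddCommGroup (E p)] [∀ p, Module ℝ (E p)] [∀ p, TopologicalSpace (E p)]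
  [TopologicalSpace (TotalSpace F E)] [FiberBundle F E] [VectorBundle ℝ F E]

/-- The annihilator of a family `𝔪` of local sections of the dual bundle: the fibre at `p` is
`{v ∈ E p | s(p)(v) = 0 for all s ∈ 𝔪 with p ∈ dom s}`. -/
def annihilator (𝔪 : Set (LocalSection n (F →L[ℝ] ℝ) (DualFiber E))) :
    GeneralizedSubbundle E := fun p =>
  { carrier := {v | ∀ s ∈ 𝔪, p ∈ s.dom → s.toFun p v = 0}
    zero_mem' := fun s _ _ => map_zero (s.toFun p)
    add_mem' := fun {v w} hv hw s hs hp => by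
      rw [map_add, hv s hs hp, hw s hs hp, add_zero]
    smul_mem' := fun c v hv s hs hp => by
      rw [map_smul, hv s hs hp, smul_zero] }

/-- A generalized subbundle is cosmooth if it is the annihilator of some family of local sections of
the dual bundle. -/
def IsCosmooth (n : ℕ) {M : Type*} [TopologicalSpace M]
    [ChartedSpace (EuclideanSpace ℝ (Fin n)) M]
    (F : Type*) [NormedAddCommGroup F] [NormedSpace ℝ F]
    {E : M → Type*} [∀ p, AddCommGroup (E p)] [∀ p, Module ℝ (E p)] [∀ p, TopologicalSpace (E p)]
    [TopologicalSpace (TotalSpace F E)] [FiberBundle F E] [VectorBundle ℝ F E]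
    (G : GeneralizedSubbundle E) : Prop :=
  ∃ 𝔪 : Set (LocalSection n (F →L[ℝ] ℝ) (DualFiber E)), G = annihilator 𝔪

end GeneralizedSubbundles

/-!
The finitely many sections are generic infinite combinations of sections that vanish on `G`.
A global section `t` of `E*` is a function on the total space of `E`, and a cosmooth `G` is the common
zero set of the family of all `t` that vanish on `G`: bump functions turn local sections into global
ones (`exists_contMDiffSection_eq_smul`). As the total space is second countable, a sequence `t j`
suffices (`exists_sequence_forall_apply_eq_zero`).

Let `N = n + rank E + 1`, which exceeds the dimension of the total space, and consider the combinations
`σ i = ∑ j, a j i * c j * t j` for `i < N`. The positive weights `c j` decay so fast that the series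
converges to a smooth section for every bounded sequence `a` in `ℝ^N`
(`exists_pos_mul_norm_iteratedFDeriv_le`, `contDiff_tsum_smul_of_rapid_decay`). For generic `a`, the
common zeros of `σ 0, …, σ (N - 1)` are those of all `t j`: let `K` be a compact convex set, in local
coordinates of the total space, on which some `t j₀` has no zero. The sequences `a` for which the `σ i`
have a common zero on `K` form a closed set (`isOpen_setOf_forall_tsum_smul_ne_zero`). It is nowhere
dense: with all coefficients but `a j₀` fixed, a common zero at `z` determines `a j₀` as a smooth
function of `z`, so that the bad values of `a j₀` form the image of `K` under a smooth map into `ℝ^N`,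
and the dimension of `K` is less than `N` (`dense_setOf_forall_tsum_smul_ne_zero`). Countably many
such `K` cover the complement of `G`, and Baire's theorem in the space of bounded sequences gives a
good `a` (`exists_combinations_of_sequence`).

Everything is computed in countably many charts and trivializations, where a section multiplied by a
cutoff function becomes a smooth compactly supported function `ℝ^n → F*` (`cutoffRepr`).
-/

open Bundle Set Filter Topology Module
open scoped Manifold ContDiff BoundedContinuousFunction

/-! ### Rapidly decaying coefficients -/

section Decay

variable {X V : Type*} [NormedAddCommGroup X] [NormedSpace ℝ X]
  [NormedAddCommGroup V] [NormedSpace ℝ V]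

/-- A diagonal choice: `c j` only has to control the derivatives of order at most `j` of the first
`j + 1` functions `T l j`, which are bounded because of compact support. The same `c` thus serves all
`l` and all orders of differentiation at once. -/
theorem exists_pos_mul_norm_iteratedFDeriv_le (T : ℕ → ℕ → X → V)
    (hT : ∀ l j, ContDiff ℝ ∞ (T l j)) (hc : ∀ l j, HasCompactSupport (T l j)) :
    ∃ c : ℕ → ℝ, (∀ j, 0 < c j) ∧ ∀ l k j, l ≤ j → k ≤ j → ∀ y,
      c j * ‖iteratedFDeriv ℝ k (T l j) y‖ ≤ (1 / 2 : ℝ) ^ j := by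
  have hb : ∀ l k j, ∃ C : ℝ, ∀ y, ‖iteratedFDeriv ℝ k (T l j) y‖ ≤ C := fun l k j =>
    ((hT l j).continuous_iteratedFDeriv (mod_cast le_top)).bounded_above_of_compact_support
      ((hc l j).iteratedFDeriv k)
  choose C hC using hb
  have hC0 : ∀ l k j, 0 ≤ C l k j := fun l k j => (norm_nonneg _).trans (hC l k j 0)
  set D : ℕ → ℝ := fun j =>
    1 + ∑ l ∈ Finset.range (j + 1), ∑ k ∈ Finset.range (j + 1), C l k j with hD
  have hD1 : ∀ j, 1 ≤ D j := fun j => by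
    have : 0 ≤ ∑ l ∈ Finset.range (j + 1), ∑ k ∈ Finset.range (j + 1), C l k j :=
      Finset.sum_nonneg fun l _ => Finset.sum_nonneg fun k _ => hC0 l k j
    simp only [hD]; linarith
  have hCD : ∀ l k j, l ≤ j → k ≤ j → C l k j ≤ D j := fun l k j hl hk => by
    have h1 : C l k j ≤ ∑ k ∈ Finset.range (j + 1), C l k j :=
      Finset.single_le_sum (f := fun k => C l k j) (fun k _ => hC0 l k j)
        (Finset.mem_range.2 (by omega))
    have h2 : ∑ k ∈ Finset.range (j + 1), C l k j ≤
        ∑ l ∈ Finset.range (j + 1), ∑ k ∈ Finset.range (j + 1), C l k j :=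
      Finset.single_le_sum (f := fun l => ∑ k ∈ Finset.range (j + 1), C l k j)
        (fun l _ => Finset.sum_nonneg fun k _ => hC0 l k j) (Finset.mem_range.2 (by omega))
    simp only [hD]; linarith
  refine ⟨fun j => (1 / 2) ^ j / D j, fun j => by have := hD1 j; positivity, ?_⟩
  intro l k j hl hk y
  have hDj : 0 < D j := by have := hD1 j; linarith
  rw [div_mul_eq_mul_div, div_le_iff₀ hDj]
  have := (hC l k j y).trans (hCD l k j hl hk)
  gcongr

theorem contDiff_tsum_smul_of_rapid_decay [CompleteSpace V] {T : ℕ → X → V}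
    (hT : ∀ j, ContDiff ℝ ∞ (T j)) {c : ℕ → ℝ} (hc0 : ∀ j, 0 < c j)
    (hc : ∀ k, ∀ᶠ j in atTop, ∀ y, c j * ‖iteratedFDeriv ℝ k (T j) y‖ ≤ (1 / 2 : ℝ) ^ j)
    {b : ℕ → ℝ} {A : ℝ} (hb : ∀ j, |b j| ≤ A) :
    ContDiff ℝ ∞ fun y => ∑' j, (b j * c j) • T j y := by
  refine contDiff_tsum_of_eventually (v := fun _ j => A * (1 / 2 : ℝ) ^ j)
    (fun j => (hT j).const_smul _)
    (fun k _ => (summable_geometric_two).mul_left A) fun k _ => ?_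
  rw [Nat.cofinite_eq_atTop]
  filter_upwards [hc k] with j hj y
  rw [iteratedFDeriv_const_smul_apply' ((hT j).contDiffAt.of_le (mod_cast le_top)), norm_smul,
    norm_mul, Real.norm_eq_abs, Real.norm_eq_abs, abs_of_pos (hc0 j), mul_assoc]
  have hA : 0 ≤ A := (abs_nonneg _).trans (hb j)
  have h1 := hj y
  have h0 : 0 ≤ c j * ‖iteratedFDeriv ℝ k (T j) y‖ := mul_nonneg (hc0 j).le (norm_nonneg _)
  exact mul_le_mul (hb j) h1 h0 hA

/-- Finitely many functions lie outside the range where the decay estimate applies; these are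
bounded because they have compact support. -/
theorem exists_summable_bound_of_rapid_decay {X V : Type*} [TopologicalSpace X]
    [NormedAddCommGroup V] {T : ℕ → X → V} (hT : ∀ j, Continuous (T j))
    (hs : ∀ j, HasCompactSupport (T j)) {c : ℕ → ℝ}
    (hc : ∀ᶠ j in atTop, ∀ y, c j * ‖T j y‖ ≤ (1 / 2 : ℝ) ^ j) :
    ∃ u : ℕ → ℝ, Summable u ∧ ∀ j y, c j * ‖T j y‖ ≤ u j := by
  choose B hB using fun j => (hT j).bounded_above_of_compact_support (hs j)
  obtain ⟨m, hm⟩ := eventually_atTop.1 hc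
  refine ⟨fun j => if j < m then |c j| * B j else (1 / 2) ^ j, ?_, fun j y => ?_⟩
  · refine (summable_geometric_two).congr_atTop ?_
    filter_upwards [eventually_ge_atTop m] with j hj
    rw [if_neg (by omega)]
  · beta_reduce
    split_ifs with h
    · exact mul_le_mul (le_abs_self _) (hB j y) (norm_nonneg _) (abs_nonneg _)
    · exact hm j (by omega) y

end Decay

/-! ### Generic combinations -/

section Generic

variable {Z V : Type*} [NormedAddCommGroup V] [NormedSpace ℝ V]

/-- The coefficients for which the combination vanishes somewhere on the compact set `K` form a closed
set, being the projection along `K` of a closed subset of `K × (ℕ →ᵇ V)`. -/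
theorem isOpen_setOf_forall_tsum_smul_ne_zero [TopologicalSpace Z] [CompleteSpace V]
    {K : Set Z} (hK : IsCompact K) {f : ℕ → Z → ℝ} (hf : ∀ j, ContinuousOn (f j) K) {u : ℕ → ℝ} (hu : Summable u)
    (hfu : ∀ j, ∀ z ∈ K, |f j z| ≤ u j) :
    IsOpen {a : ℕ →ᵇ V | ∀ z ∈ K, ∑' j, f j z • a j ≠ 0} := by
  have : CompactSpace K := isCompact_iff_compactSpace.1 hK
  have hcont : Continuous fun q : K × (ℕ →ᵇ V) => ∑' j, f j q.1 • q.2 j := by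
    rw [continuous_iff_continuousAt]
    intro q
    -- the series converges uniformly only over bounded sets of coefficients
    set R := ‖q.2‖ + 1
    have hopen : IsOpen {q : K × (ℕ →ᵇ V) | ‖q.2‖ < R} :=
      isOpen_lt (by fun_prop) continuous_const
    refine ContinuousOn.continuousAt (s := {q : K × (ℕ →ᵇ V) | ‖q.2‖ < R}) ?_
      (hopen.mem_nhds (by simp [R]))
    refine continuousOn_tsum (u := fun j => u j * R) (fun j => ?_) (hu.mul_right R) ?_
    · have h1 : Continuous fun q : K × (ℕ →ᵇ V) => f j q.1 :=
        (continuousOn_iff_continuous_domRestrict.1 (hf j)).comp continuous_fst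
      have h2 : Continuous fun q : K × (ℕ →ᵇ V) => q.2 j :=
        (BoundedContinuousFunction.lipschitz_eval_const j).continuous.comp continuous_snd
      exact (h1.smul h2).continuousOn
    · intro j q hq
      rw [norm_smul]
      exact mul_le_mul (hfu j _ q.1.2) ((q.2.norm_coe_le_norm j).trans (le_of_lt hq))
        (norm_nonneg _) ((abs_nonneg _).trans (hfu j _ q.1.2))
  have hcl := isClosedMap_snd_of_compactSpace (X := K) (Y := ℕ →ᵇ V) _
    (isClosed_singleton.preimage hcont : IsClosed (_ ⁻¹' {(0 : V)}))
  convert! hcl.isOpen_compl using 1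
  ext a
  simp only [mem_ofPred_eq, mem_compl_iff, mem_image, mem_preimage, mem_singleton_iff, Prod.exists,
    exists_eq_right, Subtype.exists, not_exists]

/-- Changing only the `j₀`-th coefficient by `x`, the combination vanishes at `z` iff
`x = -(f j₀ z)⁻¹ • ∑' j, f j z • a j`. The bad values of `x` thus form the image of `K` under a
`C¹` map to a space of larger dimension. -/
theorem dense_setOf_forall_tsum_smul_ne_zero [NormedAddCommGroup Z] [NormedSpace ℝ Z]
    [FiniteDimensional ℝ Z] [FiniteDimensional ℝ V]
    (hdim : finrank ℝ Z < finrank ℝ V) {K : Set Z} (hK : Convex ℝ K)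
    {f : ℕ → Z → ℝ} (hf : ∀ z ∈ K, Summable fun j => |f j z|)
    (hs : ∀ a : ℕ →ᵇ V, ContDiffOn ℝ 1 (fun z => ∑' j, f j z • a j) K)
    {j₀ : ℕ} (hf0 : ContDiffOn ℝ 1 (f j₀) K) (h0 : ∀ z ∈ K, f j₀ z ≠ 0) :
    Dense {a : ℕ →ᵇ V | ∀ z ∈ K, ∑' j, f j z • a j ≠ 0} := by
  classical
  have : CompleteSpace V := FiniteDimensional.complete ℝ V
  have hsum : ∀ a : ℕ →ᵇ V, ∀ z ∈ K, Summable fun j => f j z • a j := fun a z hz =>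
    Summable.of_norm_bounded ((hf z hz).mul_right ‖a‖) fun j => by
      rw [norm_smul]
      exact mul_le_mul_of_nonneg_left (a.norm_coe_le_norm j) (abs_nonneg _)
  rw [Metric.dense_iff]
  intro a r hr
  have hK' : dimH K < finrank ℝ V :=
    (dimH_mono (subset_univ K)).trans_lt (by rw [Real.dimH_univ_eq_finrank]; exact_mod_cast hdim)
  have hd := ((hf0.inv h0).neg.smul (hs a)).dense_compl_image_of_dimH_lt_finrank hK subset_rfl hK'
  obtain ⟨x, hxr, hx⟩ := Metric.dense_iff.1 hd 0 (r / 2) (half_pos hr)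
  have hx' : ‖x‖ < r / 2 := by simpa using hxr
  let e : ℕ →ᵇ V := BoundedContinuousFunction.ofNormedAddCommGroupDiscrete
    (Pi.single j₀ x) ‖x‖ fun j => by
      rcases eq_or_ne j j₀ with rfl | h
      · simp
      · simp [h]
  have he : ∀ j, e j = (Pi.single j₀ x : ℕ → V) j := fun j => rfl
  have hen : ‖e‖ ≤ ‖x‖ := BoundedContinuousFunction.norm_ofNormedAddCommGroup_le _ (norm_nonneg _) _
  refine ⟨a + e, ?_, fun z hz hz0 => hx ⟨z, hz, ?_⟩⟩
  · rw [mem_ball_iff_norm, add_sub_cancel_left]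
    linarith
  · have h1 : ∑' j, f j z • (a + e) j = ∑' j, f j z • a j + f j₀ z • x := by
      simp only [BoundedContinuousFunction.add_apply, smul_add]
      rw [(hsum a z hz).tsum_add (hsum e z hz), tsum_eq_single (f := fun j => f j z • e j) j₀]
      · simp [he]
      · intro j hj; simp [he, hj]
    rw [h1, add_eq_zero_iff_eq_neg] at hz0
    change (-(f j₀ z)⁻¹) • ∑' j, f j z • a j = x
    rw [hz0, smul_neg, neg_smul, neg_neg, smul_smul, inv_mul_cancel₀ (h0 z hz), one_smul]

end Generic

/-! ### Reduction to finitely many combinations in coordinates -/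

section Reduction

variable {X F : Type*} [NormedAddCommGroup X] [NormedSpace ℝ X] [FiniteDimensional ℝ X]
  [NormedAddCommGroup F] [NormedSpace ℝ F] [FiniteDimensional ℝ F]

/-- An open set of a finite-dimensional space is a countable union of closed balls. -/
theorem exists_countable_closedBall_cover {Z : Type*} [NormedAddCommGroup Z] [NormedSpace ℝ Z]
    [FiniteDimensional ℝ Z] {O : Set Z} (hO : IsOpen O) :
    ∃ (S : Set Z) (r : Z → ℝ), S.Countable ∧ (∀ z ∈ S, Metric.closedBall z (r z) ⊆ O) ∧
      O ⊆ ⋃ z ∈ S, Metric.closedBall z (r z) := by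
  have := FiniteDimensional.proper ℝ Z
  have h : ∀ z : Z, ∃ r : ℝ, 0 < r ∧ (z ∈ O → Metric.closedBall z r ⊆ O) := fun z => by
    by_cases hz : z ∈ O
    · obtain ⟨r, hr, h⟩ := Metric.nhds_basis_closedBall.mem_iff.1 (hO.mem_nhds hz)
      exact ⟨r, hr, fun _ => h⟩
    · exact ⟨1, one_pos, fun h => absurd h hz⟩
  choose r hr hsub using h
  obtain ⟨S, hS, hSc, hcov⟩ := TopologicalSpace.countable_cover_nhdsWithin
    (f := fun z => Metric.closedBall z (r z)) (s := O)
    fun z _ => mem_nhdsWithin_of_mem_nhds (Metric.closedBall_mem_nhds z (hr z))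
  exact ⟨S, r, hSc, fun z hz => hsub z (hS hz), hcov⟩

/-- Countably many sequences of functionals depending smoothly on `y`, all combined with the same
coefficients: `finrank X + finrank F + 1` combinations suffice to have the same common zeros in
`X × F` as the whole sequence, for each `l`. The coefficients are bounded sequences that are
generic in the sense of Baire, damped by rapidly decaying weights. -/
theorem exists_combinations_of_sequence (T : ℕ → ℕ → X → F →L[ℝ] ℝ)
    (hT : ∀ l j, ContDiff ℝ ∞ (T l j)) (hc : ∀ l j, HasCompactSupport (T l j))
    {N : ℕ} (hN : finrank ℝ X + finrank ℝ F < N) :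
    ∃ a : Fin N → ℕ → ℝ, (∀ i l y, Summable fun j => a i j • T l j y) ∧
      (∀ i l, ContDiff ℝ ∞ fun y => ∑' j, a i j • T l j y) ∧
      ∀ l y w, (∀ i, (∑' j, a i j • T l j y) w = 0) → ∀ j, T l j y w = 0 := by
  have := FiniteDimensional.proper ℝ X
  have := FiniteDimensional.proper ℝ F
  obtain ⟨c, hc0, hcd⟩ := exists_pos_mul_norm_iteratedFDeriv_le T hT hc
  have hcd' : ∀ l k, ∀ᶠ j in atTop, ∀ y,
      c j * ‖iteratedFDeriv ℝ k (T l j) y‖ ≤ (1 / 2 : ℝ) ^ j := fun l k => by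
    filter_upwards [eventually_ge_atTop l, eventually_ge_atTop k] with j hl hk
    exact hcd l k j hl hk
  have hu : ∀ l, ∃ u : ℕ → ℝ, Summable u ∧ ∀ j y, c j * ‖T l j y‖ ≤ u j := fun l =>
    exists_summable_bound_of_rapid_decay (fun j => (hT l j).continuous) (hc l)
      (by simpa using hcd' l 0)
  choose u hus hu using hu
  -- the real-valued function on `X × F` attached to a family of functionals
  set f : ℕ → ℕ → X × F → ℝ := fun l j z => c j * T l j z.1 z.2 with hf
  have hfs : ∀ l j, ContDiff ℝ ∞ (f l j) := fun l j =>
    contDiff_const.mul (((hT l j).comp contDiff_fst).clm_apply contDiff_snd)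
  have hfu : ∀ l j z, |f l j z| ≤ u l j * ‖z.2‖ := fun l j z => by
    rw [hf, abs_mul, abs_of_pos (hc0 j)]
    calc c j * |T l j z.1 z.2| ≤ c j * (‖T l j z.1‖ * ‖z.2‖) := by
          gcongr
          · exact (hc0 j).le
          · exact (T l j z.1).le_opNorm z.2
      _ = c j * ‖T l j z.1‖ * ‖z.2‖ := by ring
      _ ≤ _ := by gcongr; exact hu l j z.1
  have hsumT : ∀ (a : ℕ →ᵇ (Fin N → ℝ)) i l y, Summable fun j => (a j i * c j) • T l j y :=
    fun a i l y => Summable.of_norm_bounded ((hus l).mul_left ‖a‖) fun j => by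
      rw [norm_smul, norm_mul, Real.norm_of_nonneg (hc0 j).le, mul_assoc]
      have h1 := (norm_le_pi_norm (a j) i).trans (a.norm_coe_le_norm j)
      exact mul_le_mul h1 (hu l j y) (mul_nonneg (hc0 j).le (norm_nonneg _)) (norm_nonneg _)
  have hsmT : ∀ (a : ℕ →ᵇ (Fin N → ℝ)) i l,
      ContDiff ℝ ∞ fun y => ∑' j, (a j i * c j) • T l j y := fun a i l =>
    contDiff_tsum_smul_of_rapid_decay (hT l) hc0 (hcd' l) (b := fun j => a j i) (A := ‖a‖)
      fun j => (norm_le_pi_norm (a j) i).trans (a.norm_coe_le_norm j)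
  have hfsum : ∀ l z, Summable fun j => |f l j z| := fun l z =>
    Summable.of_nonneg_of_le (fun _ => abs_nonneg _) (hfu l · z) ((hus l).mul_right _)
  have hcoord : ∀ (a : ℕ →ᵇ (Fin N → ℝ)) l z i,
      (∑' j, f l j z • a j) i = (∑' j, (a j i * c j) • T l j z.1) z.2 := fun a l z i => by
    have hs : Summable fun j => f l j z • a j :=
      Summable.of_norm_bounded ((hfsum l z).mul_right ‖a‖) fun j => by
        rw [norm_smul]
        exact mul_le_mul_of_nonneg_left (a.norm_coe_le_norm j) (abs_nonneg _)
    rw [tsum_apply hs, ← ContinuousLinearMap.apply_apply z.2 (∑' j, _),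
      ContinuousLinearMap.map_tsum _ (hsumT a i l z.1)]
    refine tsum_congr fun j => ?_
    simp [hf]; ring
  -- Each set `f l j ≠ 0` is a countable union of compact convex sets `K`, and coefficients are generic
  -- if the `N` combinations have no common zero on any of these.
  choose S r hSc hSsub hScov using fun l j =>
    exists_countable_closedBall_cover (O := {z | f l j z ≠ 0})
      (isOpen_ne_fun (hfs l j).continuous continuous_const)
  have hres : ∀ᶠ a : ℕ →ᵇ (Fin N → ℝ) in residual _, ∀ l j, ∀ z₀ ∈ S l j,
      ∀ z ∈ Metric.closedBall z₀ (r l j z₀), ∑' i, f l i z • a i ≠ 0 := by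
    simp only [eventually_countable_forall]
    intro l j
    rw [eventually_countable_ball (hSc l j)]
    intro z₀ hz₀
    set K := Metric.closedBall z₀ (r l j z₀)
    have hK : IsCompact K := isCompact_closedBall _ _
    obtain ⟨C, hC⟩ := hK.isBounded.exists_norm_le
    refine residual_of_dense_open ?_ ?_
    · refine isOpen_setOf_forall_tsum_smul_ne_zero hK
        (fun j => (hfs l j).continuous.continuousOn) (u := fun j => u l j * C)
        ((hus l).mul_right C) fun j z hz => (hfu l j z).trans ?_
      have hu0 : 0 ≤ u l j := (mul_nonneg (hc0 j).le (norm_nonneg _)).trans (hu l j z.1)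
      exact mul_le_mul_of_nonneg_left ((norm_snd_le z).trans (hC z hz)) hu0
    · refine dense_setOf_forall_tsum_smul_ne_zero (by simpa using hN) (convex_closedBall _ _)
        (fun z _ => hfsum l z) (fun a => ?_) ((hfs l j).of_le (mod_cast le_top)).contDiffOn
        (fun z hz => hSsub l j z₀ hz₀ hz)
      refine ContDiff.contDiffOn (contDiff_pi.2 fun i => ?_)
      simp only [hcoord]
      exact (((hsmT a i l).comp contDiff_fst).clm_apply contDiff_snd).of_le (mod_cast le_top)
  obtain ⟨a, ha⟩ := (dense_of_mem_residual hres).nonempty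
  refine ⟨fun i j => a j i * c j, fun i l y => hsumT a i l y, fun i l => hsmT a i l, ?_⟩
  intro l y w h j
  by_contra hne
  have hz : (y, w) ∈ {z | f l j z ≠ 0} := mul_ne_zero (hc0 j).ne' hne
  obtain ⟨z₀, hz₀, hz'⟩ := mem_iUnion₂.1 (hScov l j hz)
  refine ha l j z₀ hz₀ _ hz' (funext fun i => ?_)
  rw [hcoord]
  exact h i

/-- The common zero sets in `X × F` of an arbitrary family are already cut out by a countable
subfamily, as `X × F` is hereditarily Lindelöf. -/
theorem exists_sequence_forall_apply_eq_zero {ι : Type*} [Nonempty ι] (T : ℕ → ι → X → F →L[ℝ] ℝ)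
    (hT : ∀ l t, Continuous (T l t)) :
    ∃ t : ℕ → ι, ∀ l y w, (∀ j, T l (t j) y w = 0) → ∀ τ, T l τ y w = 0 := by
  have := FiniteDimensional.proper ℝ X
  have := FiniteDimensional.proper ℝ F
  have hO : ∀ l τ, IsOpen {z : X × F | T l τ z.1 z.2 ≠ 0} := fun l τ =>
    isOpen_ne_fun (((hT l τ).comp continuous_fst).clm_apply continuous_snd) continuous_const
  choose S hSc hS using fun l => TopologicalSpace.isOpen_iUnion_countable _ (hO l)
  obtain ⟨t, ht⟩ := ((countable_iUnion hSc).insert (Classical.arbitrary ι)).exists_eq_range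
    (insert_nonempty _ _)
  refine ⟨t, fun l y w h τ => ?_⟩
  by_contra hne
  have : (y, w) ∈ ⋃ τ ∈ S l, {z : X × F | T l τ z.1 z.2 ≠ 0} := by
    rw [hS l]; exact mem_iUnion.2 ⟨τ, hne⟩
  obtain ⟨τ', hτ', hne'⟩ := mem_iUnion₂.1 this
  obtain ⟨j, rfl⟩ : τ' ∈ range t := ht ▸ mem_insert_of_mem _ (mem_iUnion.2 ⟨l, hτ'⟩)
  exact hne' (h j)

end Reduction

/-! ### Sections in cut-off coordinates -/

section Coordinates

variable {n : ℕ} {M : Type*} [TopologicalSpace M] [ChartedSpace (EuclideanSpace ℝ (Fin n)) M]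

/-- The local representation of a section `s` in the chart and the trivialization at `x`, multiplied
by a cutoff function `χ` on the model space. With `tsupport χ` inside the domain of validity
of these coordinates, this is a smooth compactly supported function on the model space. -/
noncomputable def cutoffRepr {V : Type*} [NormedAddCommGroup V] [NormedSpace ℝ V] {W : M → Type*}
    [TopologicalSpace (TotalSpace V W)] [∀ p, TopologicalSpace (W p)] [FiberBundle V W]
    (x : M) (χ : EuclideanSpace ℝ (Fin n) → ℝ) (s : ∀ p, W p) (y : EuclideanSpace ℝ (Fin n)) : V :=
  χ y • (trivializationAt V W x
    ⟨(extChartAt (𝓡 n) x).symm y, s ((extChartAt (𝓡 n) x).symm y)⟩).2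

section General

variable {V : Type*} [NormedAddCommGroup V] [NormedSpace ℝ V] {W : M → Type*}
  [TopologicalSpace (TotalSpace V W)] [∀ p, TopologicalSpace (W p)] [FiberBundle V W]

theorem hasCompactSupport_cutoffRepr {x : M} {χ : EuclideanSpace ℝ (Fin n) → ℝ}
    (hχ : HasCompactSupport χ) (s : ∀ p, W p) : HasCompactSupport (cutoffRepr (V := V) x χ s) :=
  hχ.smul_right

theorem cutoffRepr_extChartAt {x p : M} (hp : p ∈ (extChartAt (𝓡 n) x).source)
    (χ : EuclideanSpace ℝ (Fin n) → ℝ) (s : ∀ p, W p) :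
    cutoffRepr (V := V) x χ s (extChartAt (𝓡 n) x p) =
      χ (extChartAt (𝓡 n) x p) • (trivializationAt V W x ⟨p, s p⟩).2 := by
  rw [cutoffRepr, (extChartAt (𝓡 n) x).left_inv hp]

theorem exists_cutoff (x : M) {B : Set M} (hB : B ∈ 𝓝 x) :
    ∃ χ : EuclideanSpace ℝ (Fin n) → ℝ, ContDiff ℝ ∞ χ ∧ HasCompactSupport χ ∧
      χ (extChartAt (𝓡 n) x x) = 1 ∧
      tsupport χ ⊆ (extChartAt (𝓡 n) x).target ∩ (extChartAt (𝓡 n) x).symm ⁻¹' B := by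
  have h : (extChartAt (𝓡 n) x).target ∩ (extChartAt (𝓡 n) x).symm ⁻¹' B ∈
      𝓝 (extChartAt (𝓡 n) x x) :=
    inter_mem (extChartAt_target_mem_nhds x) (extChartAt_preimage_mem_nhds hB)
  obtain ⟨r, hr, hsub⟩ := Metric.nhds_basis_closedBall.mem_iff.1 h
  let f : ContDiffBump (extChartAt (𝓡 n) x x) := ⟨r / 2, r, half_pos hr, half_lt_self hr⟩
  refine ⟨f, f.contDiff, f.hasCompactSupport,
    f.one_of_mem_closedBall (Metric.mem_closedBall_self (half_pos hr).le), ?_⟩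
  rw [f.tsupport_eq]
  exact hsub

variable [∀ p, AddCommGroup (W p)] [∀ p, Module ℝ (W p)] [VectorBundle ℝ V W]

theorem contDiff_cutoffRepr [ContMDiffVectorBundle ∞ V W (𝓡 n)] [IsManifold (𝓡 n) ∞ M] {x : M}
    {χ : EuclideanSpace ℝ (Fin n) → ℝ} (hχ : ContDiff ℝ ∞ χ)
    (hsupp : tsupport χ ⊆ (extChartAt (𝓡 n) x).target ∩
      (extChartAt (𝓡 n) x).symm ⁻¹' (trivializationAt V W x).baseSet)
    (s : ContMDiffSection (𝓡 n) V ∞ W) : ContDiff ℝ ∞ (cutoffRepr (V := V) x χ s) := by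
  rw [← contMDiff_iff_contDiff]
  refine contMDiff_of_tsupport fun y hy => ?_
  obtain ⟨hyt, hyb⟩ := hsupp (tsupport_smul_subset_left χ _ hy)
  have h1 : ContMDiffAt (𝓡 n) 𝓘(ℝ, V) ∞ (fun p => (trivializationAt V W x ⟨p, s p⟩).2)
      ((extChartAt (𝓡 n) x).symm y) :=
    ((trivializationAt V W x).contMDiffAt_section_iff hyb).1 (s.contMDiff _)
  have h2 : ContMDiffAt 𝓘(ℝ, EuclideanSpace ℝ (Fin n)) (𝓡 n) ∞ (extChartAt (𝓡 n) x).symm y :=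
    (contMDiffOn_extChartAt_symm x).contMDiffAt ((isOpen_extChartAt_target x).mem_nhds hyt)
  exact hχ.contMDiff.contMDiffAt.smul (h1.comp y h2)

/-- Multiplying a section smooth on an open set by a bump function extends it, up to a nonzero factor
at the given point, to a global section. -/
theorem exists_contMDiffSection_eq_smul [IsManifold (𝓡 n) ∞ M] [T2Space M] {U : Set M}
    (hU : IsOpen U) {s : ∀ p, W p}
    (hs : ContMDiffOn (𝓡 n) ((𝓡 n).prod 𝓘(ℝ, V)) ∞ (fun p => (⟨p, s p⟩ : TotalSpace V W)) U)
    {p : M} (hp : p ∈ U) :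
    ∃ (ψ : M → ℝ) (t : ContMDiffSection (𝓡 n) V ∞ W), ψ p = 1 ∧ (∀ q ∉ U, ψ q = 0) ∧
      ∀ q, t q = ψ q • s q := by
  obtain ⟨f, -, hf⟩ := (SmoothBumpFunction.nhds_basis_tsupport (I := 𝓡 n) p).mem_iff.1
    (hU.mem_nhds hp)
  exact ⟨f, ⟨_, ContMDiffOn.smul_section_of_tsupport f.contMDiff.contMDiffOn hU hf hs⟩,
    f.eq_one, fun q hq => image_eq_zero_of_notMem_tsupport fun h => hq (hf h), fun q => rfl⟩

/-- A series of sections is a smooth section as soon as its local representations converge to smooth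
functions in coordinates whose cutoff functions do not vanish simultaneously. -/
theorem exists_contMDiffSection_tsum [ContMDiffVectorBundle ∞ V W (𝓡 n)]
    [IsManifold (𝓡 n) ∞ M] {s : ℕ → ContMDiffSection (𝓡 n) V ∞ W}
    {a : ℕ → ℝ} {χ : M → EuclideanSpace ℝ (Fin n) → ℝ} (hχ : ∀ x, ContDiff ℝ ∞ (χ x)) {A : Set M}
    (hA : ∀ p, ∃ x ∈ A, p ∈ (extChartAt (𝓡 n) x).source ∧ p ∈ (trivializationAt V W x).baseSet ∧
      χ x (extChartAt (𝓡 n) x p) ≠ 0)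
    (hsm : ∀ x ∈ A, ContDiff ℝ ∞ fun y => ∑' j, a j • cutoffRepr (V := V) x (χ x) (s j) y) :
    ∃ σ : ContMDiffSection (𝓡 n) V ∞ W, ∀ x ∈ A, ∀ p ∈ (extChartAt (𝓡 n) x).source,
      p ∈ (trivializationAt V W x).baseSet → χ x (extChartAt (𝓡 n) x p) ≠ 0 →
      ∑' j, a j • cutoffRepr (V := V) x (χ x) (s j) (extChartAt (𝓡 n) x p) =
        cutoffRepr (V := V) x (χ x) σ (extChartAt (𝓡 n) x p) := by
  have key : ∀ x ∈ A, ∀ p ∈ (extChartAt (𝓡 n) x).source,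
      p ∈ (trivializationAt V W x).baseSet → χ x (extChartAt (𝓡 n) x p) ≠ 0 →
      (trivializationAt V W x ⟨p, ∑' j, a j • s j p⟩).2 = (χ x (extChartAt (𝓡 n) x p))⁻¹ •
        ∑' j, a j • cutoffRepr (V := V) x (χ x) (s j) (extChartAt (𝓡 n) x p) := by
    intro x hx p hp hb h0
    set L := (trivializationAt V W x).continuousLinearEquivAt ℝ p hb with hL
    have hLs : ∀ w : W p, (trivializationAt V W x ⟨p, w⟩).2 = L w := fun w => by
      rw [hL, (trivializationAt V W x).continuousLinearEquivAt_apply ℝ p hb]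
    have : T2Space (W p) := L.toHomeomorph.isEmbedding.t2Space
    -- no summability is needed: `L` also preserves divergence, where both sums are zero
    rw [hLs, L.map_tsum, ← tsum_const_smul'']
    refine tsum_congr fun j => ?_
    rw [cutoffRepr_extChartAt hp, hLs, map_smul, smul_comm (a j), inv_smul_smul₀ h0]
  refine ⟨⟨fun p => ∑' j, a j • s j p, fun p => ?_⟩, fun x hx p hp hb h0 => ?_⟩
  · obtain ⟨x, hx, hp, hb, h0⟩ := hA p
    rw [(trivializationAt V W x).contMDiffAt_section_iff hb]
    have hc : ContMDiffAt (𝓡 n) 𝓘(ℝ, EuclideanSpace ℝ (Fin n)) ∞ (extChartAt (𝓡 n) x) p :=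
      contMDiffAt_extChartAt' (by simpa using hp)
    have hχp : ContMDiffAt (𝓡 n) 𝓘(ℝ, ℝ) ∞ (fun q => χ x (extChartAt (𝓡 n) x q)) p :=
      (hχ x).contMDiff.contMDiffAt.comp p hc
    have hinv : ContMDiffAt (𝓡 n) 𝓘(ℝ, ℝ) ∞ (fun q => (χ x (extChartAt (𝓡 n) x q))⁻¹) p :=
      hχp.inv₀ h0
    refine (hinv.smul ((hsm x hx).contMDiff.contMDiffAt.comp p hc)).congr_of_eventuallyEq ?_
    filter_upwards [(isOpen_extChartAt_source (I := 𝓡 n) x).mem_nhds hp,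
      (trivializationAt V W x).open_baseSet.mem_nhds hb,
      hχp.continuousAt.eventually_ne h0] with q hq hqb hq0
    exact key x hx q hq hqb hq0
  · rw [cutoffRepr_extChartAt hp]
    change _ = _ • (trivializationAt V W x ⟨p, ∑' j, a j • s j p⟩).2
    rw [key x hx p hp hb h0, smul_inv_smul₀ h0]

end General

section Dual

variable {F : Type*} [NormedAddCommGroup F] [NormedSpace ℝ F]
  {E : M → Type*} [∀ p, AddCommGroup (E p)] [∀ p, Module ℝ (E p)] [∀ p, TopologicalSpace (E p)]
  [TopologicalSpace (TotalSpace F E)] [FiberBundle F E] [VectorBundle ℝ F E]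

theorem trivializationAt_dualFiber_apply {x p : M} (hp : p ∈ (trivializationAt F E x).baseSet)
    (s : DualFiber E p) (v : E p) :
    (trivializationAt (F →L[ℝ] ℝ) (DualFiber E) x ⟨p, s⟩).2
      ((trivializationAt F E x).continuousLinearMapAt ℝ p v) = s v := by
  rw [hom_trivializationAt_apply]
  simpa [ContinuousLinearMap.inCoordinates] using
    congrArg s ((trivializationAt F E x).symmL_continuousLinearMapAt (R := ℝ) hp v)

theorem baseSet_trivializationAt_dualFiber (x : M) :
    (trivializationAt (F →L[ℝ] ℝ) (DualFiber E) x).baseSet = (trivializationAt F E x).baseSet := by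
  rw [hom_trivializationAt_baseSet]
  simp

end Dual

end Coordinates

/-! ### Cosmooth generalized subbundles -/

theorem corollary3 {n : ℕ} {M : Type*} [TopologicalSpace M] [T2Space M]
    [SecondCountableTopology M] [ConnectedSpace M]
    [ChartedSpace (EuclideanSpace ℝ (Fin n)) M] [IsManifold (𝓡 n) ∞ M]
    {F : Type*} [NormedAddCommGroup F] [NormedSpace ℝ F] [FiniteDimensional ℝ F]
    {E : M → Type*} [∀ p, AddCommGroup (E p)] [∀ p, Module ℝ (E p)] [∀ p, TopologicalSpace (E p)]
    [TopologicalSpace (TotalSpace F E)] [FiberBundle F E] [VectorBundle ℝ F E]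
    [ContMDiffVectorBundle ∞ F E (𝓡 n)]
    (G : GeneralizedSubbundle E) (hG : IsCosmooth n F G) :
    ∃ (k : ℕ) (s : Fin k → ContMDiffSection (𝓡 n) (F →L[ℝ] ℝ) ∞ (DualFiber E)),
      ∀ p : M, (G p : Set (E p)) = {v : E p | ∀ i : Fin k, s i p v = 0} := by
  obtain ⟨𝔪, rfl⟩ := hG
  -- the module of all global sections of the dual bundle that annihilate `G`
  let Γ := {t : ContMDiffSection (𝓡 n) (F →L[ℝ] ℝ) ∞ (DualFiber E) //
    ∀ p, ∀ v ∈ annihilator 𝔪 p, t p v = 0}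
  have : Nonempty Γ := ⟨⟨0, fun _ _ _ => rfl⟩⟩
  have hΓ : ∀ p (v : E p), (∀ t : Γ, t.1 p v = 0) → v ∈ annihilator 𝔪 p := by
    intro p v hv s hs hp
    obtain ⟨ψ, t, hψp, hψ, ht⟩ := exists_contMDiffSection_eq_smul s.dom.isOpen s.smooth hp
    have h := hv ⟨t, fun q w hw => ?_⟩
    · simpa [ht, hψp] using h
    · rw [ht]
      by_cases hq : q ∈ s.dom
      · simp [hw s hs hq]
      · simp [hψ q hq]
  choose χ hχ hχc hχ1 hχs using fun x : M => exists_cutoff (n := n) x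
    ((trivializationAt (F →L[ℝ] ℝ) (DualFiber E) x).open_baseSet.mem_nhds
      (mem_baseSet_trivializationAt (F →L[ℝ] ℝ) (DualFiber E) x))
  -- `U x` is the region where the coordinates at `x` are defined and the cutoff does not vanish
  let U : M → Set M := fun x => {p | p ∈ (extChartAt (𝓡 n) x).source ∧
    p ∈ (trivializationAt (F →L[ℝ] ℝ) (DualFiber E) x).baseSet ∧ χ x (extChartAt (𝓡 n) x p) ≠ 0}
  have hU : ∀ x, U x ∈ 𝓝 x := fun x => by
    filter_upwards [extChartAt_source_mem_nhds (I := 𝓡 n) x,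
      (trivializationAt (F →L[ℝ] ℝ) (DualFiber E) x).open_baseSet.mem_nhds
        (mem_baseSet_trivializationAt (F →L[ℝ] ℝ) (DualFiber E) x),
      ((hχ x).continuous.continuousAt.comp (continuousAt_extChartAt (I := 𝓡 n) x)).eventually_ne
        (by rw [Function.comp_apply, hχ1]; exact one_ne_zero)] with p h1 h2 h3
    exact ⟨h1, h2, h3⟩
  obtain ⟨A, hAc, hA⟩ := TopologicalSpace.countable_cover_nhds hU
  obtain ⟨x, rfl⟩ := hAc.exists_eq_range (by
    obtain ⟨p⟩ := (inferInstance : Nonempty M)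
    obtain ⟨x, hx, -⟩ := mem_iUnion₂.1 (hA ▸ mem_univ p : p ∈ ⋃ x ∈ A, U x)
    exact ⟨x, hx⟩)
  have hcov : ∀ p, ∃ l, p ∈ U (x l) := fun p => by
    simpa using (hA ▸ mem_univ p : p ∈ ⋃ y ∈ range x, U y)
  let T : ℕ → Γ → EuclideanSpace ℝ (Fin n) → F →L[ℝ] ℝ := fun l t =>
    cutoffRepr (W := DualFiber E) (x l) (χ (x l)) t.1
  have hT : ∀ l t, ContDiff ℝ ∞ (T l t) := fun l t => contDiff_cutoffRepr (hχ _) (hχs _) t.1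
  obtain ⟨t, ht⟩ := exists_sequence_forall_apply_eq_zero T fun l t => (hT l t).continuous
  obtain ⟨a, hasum, hasm, ha⟩ := exists_combinations_of_sequence (fun l j => T l (t j))
    (fun l j => hT l (t j)) (fun l j => hasCompactSupport_cutoffRepr (hχc _) _)
    (Nat.lt_succ_self (finrank ℝ (EuclideanSpace ℝ (Fin n)) + finrank ℝ F))
  choose σ hσ using fun i => exists_contMDiffSection_tsum (s := fun j => (t j).1) (a := a i) hχ
    (A := range x) (fun p => by obtain ⟨l, hl⟩ := hcov p; exact ⟨x l, mem_range_self l, hl⟩)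
    (by rintro _ ⟨l, rfl⟩; exact hasm i l)
  refine ⟨_, σ, fun p => ?_⟩
  obtain ⟨l, hp, hb, h0⟩ := hcov p
  have heval : ∀ (s : ∀ q, DualFiber E q) (v : E p),
      cutoffRepr (V := F →L[ℝ] ℝ) (W := DualFiber E) (x l) (χ (x l)) s
        (extChartAt (𝓡 n) (x l) p) ((trivializationAt F E (x l)).continuousLinearMapAt ℝ p v) =
      χ (x l) (extChartAt (𝓡 n) (x l) p) * s p v := fun s v => by
    rw [cutoffRepr_extChartAt hp, smul_apply,
      trivializationAt_dualFiber_apply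
        (baseSet_trivializationAt_dualFiber (F := F) (E := E) (x l) ▸ hb),
      smul_eq_mul]
  ext v
  set y := extChartAt (𝓡 n) (x l) p
  set w := (trivializationAt F E (x l)).continuousLinearMapAt ℝ p v
  have hσv : ∀ i, (∑' j, a i j • T l (t j) y) w = χ (x l) y * σ i p v := fun i => by
    rw [← heval, ← hσ i (x l) (mem_range_self l) p hp hb h0]
  constructor
  · intro hv i
    refine (mul_eq_zero.1 (?_ : χ (x l) y * σ i p v = 0)).resolve_left h0
    rw [← hσv, ← ContinuousLinearMap.apply_apply w (∑' j, _),
      ContinuousLinearMap.map_tsum _ (hasum i l y)]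
    refine (tsum_congr fun j => ?_).trans tsum_zero
    have h : T l (t j) y w = 0 := by
      rw [heval, (t j).2 p v hv, mul_zero]
    simp [h]
  · intro hv
    refine hΓ p v fun τ => ?_
    have h := ht l y w (ha l y w fun i => by rw [hσv, hv i, mul_zero]) τ
    rw [heval] at h
    exact (mul_eq_zero.1 h).resolve_left h0
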